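/- Let $p,q\ge 0$ with $p+q=1$, and let $\beta\ge 0$. For $n\ge 0$ let $\mathcal X_n$ be the set of configurations $x=\{0\le x_1<\dots<x_n\}$ of $n$ particles on $\{0,1,2,\dots\}$ and let $\mathcal E_n=L^1(\mathcal X_n)$ (complex-valued, counting measure). Consider the asymmetric simple exclusion process on $\{0,1,2,\dots\}$: each particle jumps one step to the right at rate $p$, and one step to the left at rate $q$ unless it is at $0$, a jump being suppressed if the target site is occupied. Let $\mathfrak p_n(x,y;t)$ be the probability that this $n$-particle process, started at $y\in\mathcal X_n$, is at $x\in\mathcal X_n$ at time $t$ (so $\mathfrak p_0=1$). Consider also the process with an open boundary at $0$ with injection rate $\alpha=0$ and ejection rate $\beta$: it has the same dynamics and, in addition, a particle at site $0$ is removed at rate $\beta$. Suppose that initially there are $k\ge 0$ particles, at $y\in\mathcal X_k$. Let $P_n(x;t)$ be the probability that the open process is in configuration $x\in\mathcal X_n$ at time $t$, and for $\operatorname{Re}s>0$ let $\widehat P_n(s)=\int_0^\infty e^{-st}P_n(\,\cdot\,;t)\,dt\in\mathcal E_n$. For $\operatorname{Re}s>0$ let $L_n(s)$ be the bounded operator on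 $\mathcal E_n$ with kernel $\int_0^\infty e^{-st}\,\mathfrak p_n(x,y;t)\,dt$. Let $\delta$ be the operator on $\mathcal E_n$ of multiplication by the function that equals $1$ at $x$ if $0\in x$ and $0$ otherwise (identically $0$ when $n=0$). Let $B_n:\mathcal E_{n+1}\to\mathcal E_n$ be given by $(B_nF)(x_1,\dots,x_n)=F(0,x_1,\dots,x_n)$ if $0\notin x$, and $(B_nF)(x)=0$ otherwise; in particular $B_0F=F(0)$. Let $\delta_y\in\mathcal E_k$ be the indicator function of $y$. Then for every complex $s$ with $\operatorname{Re}s>0$ the operator $I+\beta L_n(s)\delta$ is invertible in the algebra of bounded operators on $\mathcal E_n$ for every $n\ge 0$, and with $M_n(s)=(I+\beta L_n(s)\delta)^{-1}$ we have $$\widehat P_k(s)=M_k(s)L_k(s)\delta_y,$$ and for every $0\le n<k$ $$\widehat P_n(s)=\beta\,M_n(s)L_n(s)B_n\widehat P_{n+1}(s).$$ -/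

import Mathlib

open MeasureTheory
open scoped ENNReal NNReal

noncomputable section

namespace OpenASEP

/-! ## Transition probabilities of a continuous-time Markov chain on a countable set -/

section MarkovChain

variable {S : Type*}

/-- Total rate at which a chain with jump rates `r y z` (from `y` to `z`) leaves the state `y`
(the rates out of each state are assumed to be summable). -/
def exitRate (r : S → S → ℝ≥0) (y : S) : ℝ≥0 := ∑' z, r y z

/-- The probability that the continuous-time Markov chain with jump rates `r`, started at `y`,
makes exactly `m` jumps during `[0, t]` and is at `x` at time `t`.
The chain waits at `y` for an exponential time `u` whose parameter is the exit rate of `y`, then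
jumps to `z` with probability `r y z / exitRate r y`, and starts afresh from `z`; so the
time-and-place of the first jump has density `exp (-(exitRate r y) * u) * r y z`. -/
def jumpProb [DecidableEq S] (r : S → S → ℝ≥0) : ℕ → ℝ → S → S → ℝ≥0∞
  | 0, t, y, x => if x = y then ENNReal.ofReal (Real.exp (-(exitRate r y : ℝ) * t)) else 0
  | m + 1, t, y, x => ∫⁻ u in Set.Icc (0 : ℝ) t,
      ∑' z, ENNReal.ofReal (Real.exp (-(exitRate r y : ℝ) * u)) * (r y z : ℝ≥0∞) *
        jumpProb r m (t - u) z x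

/-- The probability that the chain with jump rates `r`, started at `y`, is at `x` at time `t`. -/
def transProb [DecidableEq S] (r : S → S → ℝ≥0) (t : ℝ) (y x : S) : ℝ≥0∞ :=
  ∑' m, jumpProb r m t y x

/-- The Laplace transform in time of the probability of being at `x` when started at `y`. -/
def laplaceProb [DecidableEq S] (r : S → S → ℝ≥0) (s : ℂ) (y x : S) : ℂ :=
  ∫ t in Set.Ioi (0 : ℝ), ((transProb r t y x).toReal : ℂ) * Complex.exp (-s * t)

variable [DecidableEq S] [Countable S]

theorem measurable_jumpProb (r : S → S → ℝ≥0) (m : ℕ) :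
    ∀ y x, Measurable fun t => jumpProb r m t y x := by
  induction m with
  | zero =>
    intro y x
    simp only [jumpProb]
    split_ifs
    · fun_prop
    · fun_prop
  | succ m ih =>
    intro y x
    have h1 : ∀ t : ℝ, jumpProb r (m + 1) t y x = ∫⁻ u,
        ({a : ℝ × ℝ | 0 ≤ a.2 ∧ a.2 ≤ a.1}.indicator (fun a => ∑' z,
          ENNReal.ofReal (Real.exp (-(exitRate r y : ℝ) * a.2)) * (r y z : ℝ≥0∞) *
            jumpProb r m (a.1 - a.2) z x)) (t, u) := by
      intro t
      rw [jumpProb, ← lintegral_indicator measurableSet_Icc]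
      refine lintegral_congr fun u => ?_
      simp only [Set.indicator_apply, Set.mem_Icc, Set.mem_ofPred_eq]
    simp_rw [h1]
    refine Measurable.lintegral_prod_right' ?_
    refine Measurable.indicator ?_ ?_
    · refine Measurable.tsum fun z => ?_
      refine Measurable.mul (by fun_prop) ?_
      exact (ih z x).comp (by fun_prop)
    · exact (measurableSet_le measurable_const measurable_snd).inter
        (measurableSet_le measurable_snd measurable_fst)

theorem exp_add_lintegral (c : ℝ≥0) {t : ℝ} (ht : 0 ≤ t) :
    ENNReal.ofReal (Real.exp (-(c : ℝ) * t)) +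
      ∫⁻ u in Set.Icc (0 : ℝ) t, ENNReal.ofReal (Real.exp (-(c : ℝ) * u)) * (c : ℝ≥0∞) = 1 := by
  have h1 : ∀ u : ℝ, ENNReal.ofReal (Real.exp (-(c : ℝ) * u)) * (c : ℝ≥0∞) =
      ENNReal.ofReal (Real.exp (-(c : ℝ) * u) * c) := by
    intro u
    rw [ENNReal.ofReal_mul (Real.exp_nonneg _), ENNReal.ofReal_coe_nnreal]
  simp_rw [h1]
  have hc : Continuous fun u : ℝ => Real.exp (-(c : ℝ) * u) * c := by fun_prop
  rw [← ofReal_integral_eq_lintegral_ofReal hc.continuousOn.integrableOn_Icc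
    (Filter.Eventually.of_forall fun u => by positivity), integral_Icc_eq_integral_Ioc,
    ← intervalIntegral.integral_of_le ht]
  have h2 : ∫ u in (0 : ℝ)..t, Real.exp (-(c : ℝ) * u) * c =
      -Real.exp (-(c : ℝ) * t) - -Real.exp (-(c : ℝ) * 0) := by
    refine intervalIntegral.integral_eq_sub_of_hasDerivAt (f := fun u => -Real.exp (-(c : ℝ) * u))
      (fun u _ => ?_) (hc.intervalIntegrable _ _)
    have := (((hasDerivAt_id u).const_mul (-(c : ℝ))).exp).neg
    convert this using 1
    · ext v
      simp
    · simp
  rw [h2, ← ENNReal.ofReal_add (Real.exp_nonneg _)]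
  · simp
  · have : Real.exp (-(c : ℝ) * t) ≤ 1 := Real.exp_le_one_iff.2 (by nlinarith [c.2])
    simpa using this

theorem sum_jumpProb_le (r : S → S → ℝ≥0) (hr : ∀ y, Summable (r y)) (M : ℕ) :
    ∀ y (t : ℝ), 0 ≤ t → ∑ m ∈ Finset.range M, ∑' x, jumpProb r m t y x ≤ 1 := by
  induction M with
  | zero => simp
  | succ M ih =>
    intro y t ht
    have hstep : ∀ m, ∑' x, jumpProb r (m + 1) t y x = ∫⁻ u in Set.Icc (0 : ℝ) t,
        ∑' z, ENNReal.ofReal (Real.exp (-(exitRate r y : ℝ) * u)) * (r y z : ℝ≥0∞) *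
          ∑' x, jumpProb r m (t - u) z x := by
      intro m
      simp only [jumpProb]
      rw [← lintegral_tsum]
      · refine lintegral_congr fun u => ?_
        rw [ENNReal.tsum_comm]
        simp_rw [ENNReal.tsum_mul_left]
      · intro x
        refine (Measurable.tsum fun z => ?_).aemeasurable
        refine Measurable.mul (by fun_prop) ?_
        exact (measurable_jumpProb r m z x).comp (by fun_prop)
    have h0 : ∑' x, jumpProb r 0 t y x = ENNReal.ofReal (Real.exp (-(exitRate r y : ℝ) * t)) := by
      simp only [jumpProb]
      exact tsum_ite_eq y _
    rw [Finset.sum_range_succ', h0, add_comm]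
    refine le_trans (add_le_add le_rfl ?_) (exp_add_lintegral (exitRate r y) ht).le
    simp_rw [hstep]
    rw [← lintegral_finsetSum]
    · refine setLIntegral_mono_ae' measurableSet_Icc (Filter.Eventually.of_forall fun u hu => ?_)
      rw [← Summable.tsum_finsetSum (fun _ _ => ENNReal.summable)]
      simp_rw [← Finset.mul_sum]
      have he : (exitRate r y : ℝ≥0∞) = ∑' z, (r y z : ℝ≥0∞) := by
        rw [exitRate, ENNReal.coe_tsum (hr y)]
      rw [he, ← ENNReal.tsum_mul_left]
      refine ENNReal.tsum_le_tsum fun z => ?_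
      refine (mul_le_mul_right (ih z (t - u) (sub_nonneg.2 hu.2)) _).trans ?_
      rw [mul_one]
    · intro m _
      refine Measurable.tsum fun z => ?_
      refine Measurable.mul (by fun_prop) ?_
      refine Measurable.tsum fun x => ?_
      exact (measurable_jumpProb r m z x).comp (by fun_prop)

/-- The transition probabilities sum to at most one. -/
theorem tsum_transProb_le (r : S → S → ℝ≥0) (hr : ∀ y, Summable (r y)) (y : S) {t : ℝ}
    (ht : 0 ≤ t) : ∑' x, transProb r t y x ≤ 1 := by
  simp only [transProb]
  rw [ENNReal.tsum_comm]
  exact ENNReal.tsum_le_of_sum_range_le fun M => sum_jumpProb_le r hr M y t ht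

theorem lintegral_exp_neg {a : ℝ} (ha : 0 < a) :
    ∫⁻ t in Set.Ioi (0 : ℝ), ENNReal.ofReal (Real.exp (-a * t)) = ENNReal.ofReal (1 / a) := by
  rw [← ofReal_integral_eq_lintegral_ofReal (integrableOn_exp_mul_Ioi (neg_lt_zero.2 ha) 0)
    (Filter.Eventually.of_forall fun u => by positivity), integral_exp_mul_Ioi (neg_lt_zero.2 ha)]
  congr 1
  simp

/-- The Laplace transforms of the transition probabilities are summable over the final state. -/
theorem tsum_laplaceProb_le (r : S → S → ℝ≥0) (hr : ∀ y, Summable (r y)) {s : ℂ} (hs : 0 < s.re)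
    (y : S) : ∑' x, ‖laplaceProb r s y x‖ₑ ≤ ENNReal.ofReal (1 / s.re) := by
  have hle : ∀ t : ℝ, ∀ x, ‖((transProb r t y x).toReal : ℂ) * Complex.exp (-s * t)‖ₑ ≤
      transProb r t y x * ENNReal.ofReal (Real.exp (-s.re * t)) := by
    intro t x
    rw [enorm_mul]
    refine mul_le_mul' ?_ ?_
    · rw [← ofReal_norm, Complex.norm_real, Real.norm_of_nonneg ENNReal.toReal_nonneg]
      exact ENNReal.ofReal_toReal_le
    · rw [← ofReal_norm, Complex.norm_exp]
      simp
  have hmeas : ∀ x, Measurable fun t => transProb r t y x := fun x =>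
    Measurable.tsum fun m => measurable_jumpProb r m y x
  calc ∑' x, ‖laplaceProb r s y x‖ₑ
      ≤ ∑' x, ∫⁻ t in Set.Ioi (0 : ℝ),
          transProb r t y x * ENNReal.ofReal (Real.exp (-s.re * t)) := by
        refine ENNReal.tsum_le_tsum fun x => ?_
        exact (enorm_integral_le_lintegral_enorm _).trans (lintegral_mono fun t => hle t x)
    _ = ∫⁻ t in Set.Ioi (0 : ℝ), ∑' x,
          transProb r t y x * ENNReal.ofReal (Real.exp (-s.re * t)) := by
        rw [lintegral_tsum]
        intro x
        exact ((hmeas x).mul (by fun_prop)).aemeasurable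
    _ ≤ ∫⁻ t in Set.Ioi (0 : ℝ), ENNReal.ofReal (Real.exp (-s.re * t)) := by
        refine setLIntegral_mono_ae' measurableSet_Ioi
          (Filter.Eventually.of_forall fun t ht => ?_)
        rw [ENNReal.tsum_mul_right]
        calc _ ≤ 1 * ENNReal.ofReal (Real.exp (-s.re * t)) :=
              mul_le_mul' (tsum_transProb_le r hr y (le_of_lt ht)) le_rfl
          _ = _ := one_mul _
    _ = ENNReal.ofReal (1 / s.re) := lintegral_exp_neg hs

end MarkovChain

/-! ## Operators on `L¹` of a countable set -/

section Operators

variable {X Y : Type*}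

/-- The complex Lebesgue space `L¹` of a set with counting measure. -/
abbrev L1 (X : Type*) := lp (fun _ : X => ℂ) 1

theorem memL1_iff {f : X → ℂ} : Memℓp f 1 ↔ ∑' x, ‖f x‖ₑ ≠ ∞ := by
  rw [memℓp_gen_iff (by simp)]
  simp only [ENNReal.toReal_one, Real.rpow_one]
  have : ∀ x, ‖f x‖ₑ = ((‖f x‖₊ : ℝ≥0) : ℝ≥0∞) := fun x => rfl
  simp_rw [this, ENNReal.tsum_coe_ne_top_iff_summable, ← NNReal.summable_coe, coe_nnnorm]

theorem enorm_L1 (f : L1 X) : ‖f‖ₑ = ∑' x, ‖f x‖ₑ := by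
  have hs : Summable fun x => ‖f x‖₊ := by
    have h := memL1_iff.1 (lp.memℓp f)
    exact ENNReal.tsum_coe_ne_top_iff_summable.1 h
  have h1 : ‖f‖ = ∑' x, ‖f x‖ := by
    rw [lp.norm_eq_tsum_rpow (by simp)]
    simp
  have h2 : ‖f‖₊ = ∑' x, ‖f x‖₊ := by
    apply NNReal.eq
    rw [coe_nnnorm, h1, NNReal.coe_tsum]
    simp
  change ((‖f‖₊ : ℝ≥0) : ℝ≥0∞) = ∑' x, ((‖f x‖₊ : ℝ≥0) : ℝ≥0∞)
  rw [h2, ENNReal.coe_tsum hs]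

theorem norm_le_of_tsum_le {C : ℝ} (hC : 0 ≤ C) (f : L1 Y) (g : L1 X)
    (h : ∑' x, ‖g x‖ₑ ≤ ENNReal.ofReal C * ∑' y, ‖f y‖ₑ) : ‖g‖ ≤ C * ‖f‖ := by
  rw [← enorm_L1, ← enorm_L1, ← ofReal_norm, ← ofReal_norm,
    ← ENNReal.ofReal_mul hC] at h
  exact (ENNReal.ofReal_le_ofReal_iff (by positivity)).1 h

section Kernel

variable {K : X → Y → ℂ} {C : ℝ}

theorem kernel_tsum_le (hK : ∀ y, ∑' x, ‖K x y‖ₑ ≤ ENNReal.ofReal C) (f : L1 Y) :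
    ∑' x, ∑' y, ‖K x y * f y‖ₑ ≤ ENNReal.ofReal C * ∑' y, ‖f y‖ₑ := by
  rw [ENNReal.tsum_comm, ← ENNReal.tsum_mul_left]
  refine ENNReal.tsum_le_tsum fun y => ?_
  simp_rw [enorm_mul]
  rw [ENNReal.tsum_mul_right]
  exact mul_le_mul' (hK y) le_rfl

theorem kernel_summable (hK : ∀ y, ∑' x, ‖K x y‖ₑ ≤ ENNReal.ofReal C) (f : L1 Y) (x : X) :
    Summable fun y => K x y * f y := by
  have h1 : ∑' x, ∑' y, ‖K x y * f y‖ₑ ≠ ∞ :=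
    ne_top_of_le_ne_top (ENNReal.mul_ne_top ENNReal.ofReal_ne_top (memL1_iff.1 (lp.memℓp f)))
      (kernel_tsum_le hK f)
  have h2 : ∑' y, ((‖K x y * f y‖₊ : ℝ≥0) : ℝ≥0∞) ≠ ∞ := ENNReal.ne_top_of_tsum_ne_top h1 x
  exact Summable.of_nnnorm (ENNReal.tsum_coe_ne_top_iff_summable.1 h2)

theorem kernel_enorm_le (hK : ∀ y, ∑' x, ‖K x y‖ₑ ≤ ENNReal.ofReal C) (f : L1 Y) :
    ∑' x, ‖∑' y, K x y * f y‖ₑ ≤ ENNReal.ofReal C * ∑' y, ‖f y‖ₑ := by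
  refine le_trans (ENNReal.tsum_le_tsum fun x => ?_) (kernel_tsum_le hK f)
  exact enorm_tsum_le_tsum_enorm

/-- The bounded operator `(T f)(x) = ∑ y, K x y * f y` from `L¹(Y)` to `L¹(X)`, for a kernel whose
columns have uniformly bounded `L¹` norm. -/
def kernelOp (K : X → Y → ℂ) (C : ℝ) (hC : 0 ≤ C)
    (hK : ∀ y, ∑' x, ‖K x y‖ₑ ≤ ENNReal.ofReal C) : L1 Y →L[ℂ] L1 X :=
  LinearMap.mkContinuous
    { toFun := fun f => ⟨fun x => ∑' y, K x y * f y, memL1_iff.2 (ne_top_of_le_ne_top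
        (ENNReal.mul_ne_top ENNReal.ofReal_ne_top (memL1_iff.1 (lp.memℓp f)))
        (kernel_enorm_le hK f))⟩
      map_add' := fun f g => by
        ext x
        change ∑' y, K x y * (f y + g y) = ∑' y, K x y * f y + ∑' y, K x y * g y
        rw [← (kernel_summable hK f x).tsum_add (kernel_summable hK g x)]
        simp_rw [mul_add]
      map_smul' := fun c f => by
        ext x
        change ∑' y, K x y * (c * f y) = c * ∑' y, K x y * f y
        rw [← tsum_mul_left]
        exact tsum_congr fun y => by ring }
    C (fun f => norm_le_of_tsum_le hC f _ (kernel_enorm_le hK f))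

end Kernel

theorem tsum_dite_le (P : X → Prop) [DecidablePred P] (e : {x // P x} → Y)
    (he : Function.Injective e) (f : Y → ℂ) :
    ∑' x, ‖(if h : P x then f (e ⟨x, h⟩) else 0 : ℂ)‖ₑ ≤ ∑' y, ‖f y‖ₑ := by
  have h1 : ∑' x : {x // P x}, ‖f (e x)‖ₑ =
      ∑' x, ‖(if h : P x then f (e ⟨x, h⟩) else 0 : ℂ)‖ₑ := by
    rw [← tsum_subtype_eq_of_support_subset (s := {x | P x})]
    · refine tsum_congr fun x => ?_
      have hx : P x.1 := x.2
      simp [hx]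
    · intro x hx
      by_contra hP
      exact hx (by simp [show ¬ P x from hP])
  rw [← h1]
  exact ENNReal.tsum_comp_le_tsum_of_injective he fun y => ‖f y‖ₑ

end Operators

/-! ## The exclusion process on the nonnegative integers -/

/-- Jump rates of the exclusion process without reservoir, from the configuration `η` (the finite
set of occupied sites) to `ξ`: every particle jumps one step to the right at rate `p` and, unless
it is at `0`, one step to the left at rate `q`, provided that the target site is empty. -/
def asepRate (p q : ℝ≥0) (η ξ : Finset ℕ) : ℝ≥0 :=
  ∑ i ∈ η, ((if i + 1 ∉ η ∧ ξ = insert (i + 1) (η.erase i) then p else 0) +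
    (if 0 < i ∧ i - 1 ∉ η ∧ ξ = insert (i - 1) (η.erase i) then q else 0))

/-- Jump rates of the exclusion process with an open boundary at `0`: additionally, a particle is
injected at `0` at rate `α` if `0` is empty and ejected from `0` at rate `β` if `0` is occupied. -/
def openRate (p q α β : ℝ≥0) (η ξ : Finset ℕ) : ℝ≥0 :=
  asepRate p q η ξ + (if 0 ∉ η ∧ ξ = insert 0 η then α else 0) +
    (if 0 ∈ η ∧ ξ = η.erase 0 then β else 0)

theorem summable_ite (P : Prop) [Decidable P] (ζ : Finset ℕ) (a : ℝ≥0) :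
    Summable fun ξ : Finset ℕ => if P ∧ ξ = ζ then a else 0 := by
  refine summable_of_ne_finset_zero (s := {ζ}) fun ξ hξ => ?_
  rw [Finset.mem_singleton] at hξ
  simp [hξ]

theorem summable_asepRate (p q : ℝ≥0) (η : Finset ℕ) : Summable (asepRate p q η) := by
  unfold asepRate
  refine summable_sum fun i _ => (summable_ite _ _ _).add ?_
  simp_rw [← and_assoc]
  exact summable_ite _ _ _

theorem summable_openRate (p q α β : ℝ≥0) (η : Finset ℕ) : Summable (openRate p q α β η) :=
  ((summable_asepRate p q η).add (summable_ite _ _ _)).add (summable_ite _ _ _)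

/-- Configurations of `n` particles. -/
abbrev Config (n : ℕ) := {x : Finset ℕ // x.card = n}

/-- The space `L¹` of the set of configurations of `n` particles. -/
abbrev E (n : ℕ) := L1 (Config n)

theorem tsum_config_le (r : Finset ℕ → Finset ℕ → ℝ≥0) (hr : ∀ y, Summable (r y)) {s : ℂ}
    (hs : 0 < s.re) (n : ℕ) (y : Finset ℕ) :
    ∑' x : Config n, ‖laplaceProb r s y x.1‖ₑ ≤ ENNReal.ofReal (1 / s.re) :=
  (ENNReal.tsum_comp_le_tsum_of_injective Subtype.val_injective
    fun x => ‖laplaceProb r s y x‖ₑ).trans (tsum_laplaceProb_le r hr hs y)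

/-- The operator `L_n(s)` on `E n`: its kernel at `(x, y)` is the Laplace transform at `s` of the
probability that the exclusion process without reservoir goes from `y` to `x` in time `t`. -/
def opL (p q : ℝ≥0) (s : ℂ) (hs : 0 < s.re) (n : ℕ) : E n →L[ℂ] E n :=
  kernelOp (fun x y : Config n => laplaceProb (asepRate p q) s y.1 x.1) (1 / s.re) (by positivity)
    (fun y => tsum_config_le (asepRate p q) (summable_asepRate p q) hs n y.1)

/-- Multiplication by the indicator that the site `0` is occupied (zero on the empty
configuration). -/
def opDelta (n : ℕ) : E n →L[ℂ] E n :=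
  LinearMap.mkContinuous
    { toFun := fun f => ⟨fun x => if 0 ∈ x.1 then f x else 0, memL1_iff.2
        (ne_top_of_le_ne_top (memL1_iff.1 (lp.memℓp f))
          (by simpa using tsum_dite_le (fun x : Config n => 0 ∈ x.1) Subtype.val
                Subtype.val_injective f))⟩
      map_add' := fun f g => by
        ext x
        change (if 0 ∈ x.1 then f x + g x else 0) =
          (if 0 ∈ x.1 then f x else 0) + (if 0 ∈ x.1 then g x else 0)
        split_ifs <;> simp
      map_smul' := fun c f => by
        ext x
        change (if 0 ∈ x.1 then c * f x else 0) = c * (if 0 ∈ x.1 then f x else 0)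
        split_ifs <;> simp }
    1 (fun f => norm_le_of_tsum_le zero_le_one f _ (by
      simpa using tsum_dite_le (fun x : Config n => 0 ∈ x.1) Subtype.val
        Subtype.val_injective f))

/-- The configuration with a particle added at the empty site `0`. -/
def addZero {n : ℕ} (x : {x : Config n // 0 ∉ x.1}) : Config (n + 1) :=
  ⟨insert 0 x.1.1, by rw [Finset.card_insert_of_notMem x.2, x.1.2]⟩

theorem addZero_injective {n : ℕ} : Function.Injective (addZero (n := n)) := by
  intro x x' h
  have h1 : insert 0 x.1.1 = insert 0 x'.1.1 := congrArg Subtype.val h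
  have h2 : (insert 0 x.1.1).erase 0 = (insert 0 x'.1.1).erase 0 := by rw [h1]
  rw [Finset.erase_insert x.2, Finset.erase_insert x'.2] at h2
  exact Subtype.ext (Subtype.ext h2)

/-- The operator `B_n` from `E (n + 1)` to `E n`: `(B_n f)(x)` is `f(0, x₁, …, xₙ)` if the site `0`
is empty in `x`, and `0` otherwise. -/
def opB (n : ℕ) : E (n + 1) →L[ℂ] E n :=
  LinearMap.mkContinuous
    { toFun := fun f => ⟨fun x => if h : 0 ∉ x.1 then f (addZero ⟨x, h⟩) else 0, memL1_iff.2
        (ne_top_of_le_ne_top (memL1_iff.1 (lp.memℓp f))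
          (tsum_dite_le (fun x : Config n => 0 ∉ x.1) addZero addZero_injective f))⟩
      map_add' := fun f g => by
        ext x
        change (if h : 0 ∉ x.1 then f (addZero ⟨x, h⟩) + g (addZero ⟨x, h⟩) else 0) =
          (if h : 0 ∉ x.1 then f (addZero ⟨x, h⟩) else 0) +
            (if h : 0 ∉ x.1 then g (addZero ⟨x, h⟩) else 0)
        split_ifs <;> simp
      map_smul' := fun c f => by
        ext x
        change (if h : 0 ∉ x.1 then c * f (addZero ⟨x, h⟩) else 0) =
          c * (if h : 0 ∉ x.1 then f (addZero ⟨x, h⟩) else 0)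
        split_ifs <;> simp }
    1 (fun f => norm_le_of_tsum_le zero_le_one f _ (by
      rw [ENNReal.ofReal_one, one_mul]
      exact tsum_dite_le (fun x : Config n => 0 ∉ x.1) addZero addZero_injective f))

/-- The operator `I - (α - β) L_n(s) δ` on `E n`. -/
def boundaryOp (p q α β : ℝ≥0) (s : ℂ) (hs : 0 < s.re) (n : ℕ) : E n →L[ℂ] E n :=
  1 - (((α : ℝ) : ℂ) - ((β : ℝ) : ℂ)) • (opL p q s hs n * opDelta n)

/-- The operator `M_n(s) = (I - (α - β) L_n(s) δ)⁻¹` on `E n`. -/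
def opM (p q α β : ℝ≥0) (s : ℂ) (hs : 0 < s.re) (n : ℕ) : E n →L[ℂ] E n :=
  Ring.inverse (boundaryOp p q α β s hs n)

/-- The vector `P̂_n(s)` in `E n`: its value at `x` is the Laplace transform at `s` of the
probability that the exclusion process with open boundary, started from the configuration `y`, is
in the configuration `x` at time `t`. -/
def Phat (p q α β : ℝ≥0) (y : Finset ℕ) (s : ℂ) (hs : 0 < s.re) (n : ℕ) : E n :=
  ⟨fun x => laplaceProb (openRate p q α β) s y x.1, memL1_iff.2 (ne_top_of_le_ne_top
    ENNReal.ofReal_ne_top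
    (tsum_config_le (openRate p q α β) (summable_openRate p q α β) hs n y))⟩

end OpenASEP

end

/-!
Fix `s` with `Re s > 0` and let `A_β = s - G + β δ` on `L¹` of the `n`-particle configurations,
where `G` is the forward generator of the exclusion process without reservoir (`forwardOp`).
The theorem says that `A_β P̂_k = δ_y` and `A_β P̂_n = β B_n P̂_{n+1}`, rewritten with
`L_n(s) = A_0⁻¹` and `A_β = A_0 + β δ`: indeed `I + β L_n(s) δ = L_n(s) A_β` (`boundaryOp_eq`), so
`M_n(s) L_n(s) = A_β⁻¹`.

Two facts carry the argument.

* `A_β` is invertible (`isUnit_forwardOp`). The exit rates on `n`-particle configurations are at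
  most `n`, so the matrix of `A_β` is strictly diagonally dominant by columns, uniformly, and a
  Neumann series converges in `L¹`.
* The Laplace transforms of the transition probabilities satisfy the forward equation
  (`laplaceProb_forward`). By definition the chain is decomposed at its first jump, which gives
  the backward recursion; for the part with exactly `m` jumps both recursions describe the same
  product of matrices, and induction on `m` turns one into the other. The sums involved are
  finite, since each configuration has finitely many predecessors and successors.

For `β = 0` the forward equation, applied to all initial states, gives `A_0 L_n(s) = 1`
(`forwardOp_mul_opL`), and `A_0` being invertible `L_n(s)` is its inverse. For general `β` it gives
the two equations for `P̂` (`forwardOp_Phat_self`, `forwardOp_Phat_of_lt`); since no particle is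
injected, `P̂_{k+1} = 0` and the recursion starts at `n = k`.
-/

open MeasureTheory
open scoped ENNReal NNReal

noncomputable section

namespace OpenASEP

/-! ### Laplace transforms of a jump chain and the forward equation -/

section Chain

variable {S : Type*} [DecidableEq S]

/-- The Laplace transform at `s` of the probability that the chain with rates `r`, started at `y`,
has made exactly `m` jumps and is at `x`. -/
def laplaceJump (r : S → S → ℝ≥0) (s : ℂ) (m : ℕ) (y x : S) : ℂ :=
  ∫ t in Set.Ioi (0 : ℝ), ((jumpProb r m t y x).toReal : ℂ) * Complex.exp (-s * t)

theorem rate_add_ne_zero {s : ℂ} (hs : 0 < s.re) (c : ℝ≥0) : s + ((c : ℝ) : ℂ) ≠ 0 := by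
  intro h
  have h1 := congrArg Complex.re h
  simp only [Complex.add_re, Complex.ofReal_re, Complex.zero_re] at h1
  linarith [c.coe_nonneg]

theorem integrableOn_cexp_neg_mul {s : ℂ} (hs : 0 < s.re) :
    IntegrableOn (fun t : ℝ => Complex.exp (-s * t)) (Set.Ioi 0) :=
  integrableOn_exp_mul_complex_Ioi (by simpa using hs) 0

theorem integral_cexp_neg_mul {s : ℂ} (hs : 0 < s.re) :
    ∫ t in Set.Ioi (0 : ℝ), Complex.exp (-s * t) = 1 / s := by
  rw [integral_exp_mul_complex_Ioi (by simpa using hs)]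
  simp

theorem laplaceJump_zero (r : S → S → ℝ≥0) {s : ℂ} (hs : 0 < s.re) (y x : S) :
    laplaceJump r s 0 y x = if x = y then 1 / (s + ((exitRate r y : ℝ) : ℂ)) else 0 := by
  unfold laplaceJump
  simp only [jumpProb]
  split_ifs with h
  · have hs' : 0 < (s + ((exitRate r y : ℝ) : ℂ)).re := by
      simp only [Complex.add_re, Complex.ofReal_re]
      positivity
    rw [← integral_cexp_neg_mul hs']
    refine integral_congr_ae (Filter.Eventually.of_forall fun t => ?_)
    dsimp only
    rw [ENNReal.toReal_ofReal (Real.exp_nonneg _), Complex.ofReal_exp, ← Complex.exp_add]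
    congr 1
    push_cast
    ring
  · simp

variable [Countable S] (r : S → S → ℝ≥0)

theorem transProb_le_one (hr : ∀ y, Summable (r y)) {t : ℝ} (ht : 0 ≤ t) (y x : S) :
    transProb r t y x ≤ 1 :=
  (ENNReal.le_tsum x).trans (tsum_transProb_le r hr y ht)

theorem jumpProb_le_one (hr : ∀ y, Summable (r y)) (m : ℕ) {t : ℝ} (ht : 0 ≤ t) (y x : S) :
    jumpProb r m t y x ≤ 1 :=
  (ENNReal.le_tsum (f := fun m => jumpProb r m t y x) m).trans (transProb_le_one r hr ht y x)

theorem aestronglyMeasurable_jumpProb_mul (s : ℂ) (m : ℕ) (y x : S) (μ : Measure ℝ) :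
    AEStronglyMeasurable
      (fun t : ℝ => ((jumpProb r m t y x).toReal : ℂ) * Complex.exp (-s * t)) μ := by
  have h1 : Measurable fun t => ((jumpProb r m t y x).toReal : ℂ) :=
    Complex.measurable_ofReal.comp (measurable_jumpProb r m y x).ennreal_toReal
  exact (h1.mul (by fun_prop)).aestronglyMeasurable

theorem integrableOn_jumpProb_mul (hr : ∀ y, Summable (r y)) {s : ℂ} (hs : 0 < s.re)
    (m : ℕ) (y x : S) :
    IntegrableOn (fun t : ℝ => ((jumpProb r m t y x).toReal : ℂ) * Complex.exp (-s * t))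
      (Set.Ioi 0) := by
  refine Integrable.mono (integrableOn_cexp_neg_mul hs)
    (aestronglyMeasurable_jumpProb_mul r s m y x _) ?_
  refine (ae_restrict_iff' measurableSet_Ioi).2 (Filter.Eventually.of_forall fun t ht => ?_)
  rw [norm_mul, Complex.norm_real, Real.norm_of_nonneg ENNReal.toReal_nonneg]
  refine mul_le_of_le_one_left (norm_nonneg _) ?_
  exact ENNReal.toReal_le_of_le_ofReal zero_le_one
    (by simpa using jumpProb_le_one r hr m (le_of_lt ht) y x)

/-- Dominated convergence: the total probability of all numbers of jumps is at most one. -/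
theorem hasSum_laplaceJump (hr : ∀ y, Summable (r y)) {s : ℂ} (hs : 0 < s.re) (y x : S) :
    HasSum (fun m => laplaceJump r s m y x) (laplaceProb r s y x) := by
  have hne : ∀ t ∈ Set.Ioi (0 : ℝ), ∑' m, jumpProb r m t y x ≠ ∞ := fun t ht =>
    ne_top_of_le_ne_top ENNReal.one_ne_top (transProb_le_one r hr (le_of_lt ht) y x)
  have hsum : ∀ t ∈ Set.Ioi (0 : ℝ),
      HasSum (fun m => (jumpProb r m t y x).toReal) (transProb r t y x).toReal := fun t ht => by
    have h := ENNReal.hasSum_toReal (hne t ht)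
    rwa [← ENNReal.tsum_toReal_eq (fun m => ENNReal.ne_top_of_tsum_ne_top (hne t ht) m)] at h
  refine hasSum_integral_of_dominated_convergence
    (fun m t => (jumpProb r m t y x).toReal * Real.exp (-s.re * t))
    (fun m => aestronglyMeasurable_jumpProb_mul r s m y x _) (fun m => ?_) ?_ ?_ ?_
  · refine Filter.Eventually.of_forall fun t => ?_
    rw [norm_mul, Complex.norm_real, Real.norm_of_nonneg ENNReal.toReal_nonneg, Complex.norm_exp]
    simp
  · exact (ae_restrict_iff' measurableSet_Ioi).2 (Filter.Eventually.of_forall fun t ht =>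
      (hsum t ht).summable.mul_right _)
  · have hb : IntegrableOn (fun t : ℝ => (transProb r t y x).toReal * Real.exp (-s.re * t))
        (Set.Ioi 0) := by
      refine Integrable.mono (integrableOn_exp_mul_Ioi (neg_lt_zero.2 hs) 0) ?_ ?_
      · have : Measurable fun t => transProb r t y x :=
          Measurable.tsum fun m => measurable_jumpProb r m y x
        exact (this.ennreal_toReal.mul (by fun_prop)).aestronglyMeasurable
      · refine (ae_restrict_iff' measurableSet_Ioi).2
          (Filter.Eventually.of_forall fun t ht => ?_)
        rw [norm_mul, Real.norm_of_nonneg ENNReal.toReal_nonneg]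
        refine mul_le_of_le_one_left (norm_nonneg _) ?_
        exact ENNReal.toReal_le_of_le_ofReal zero_le_one
          (by simpa using transProb_le_one r hr (le_of_lt ht) y x)
    refine hb.congr_fun (fun t ht => ?_) measurableSet_Ioi
    exact ((hsum t ht).mul_right _).tsum_eq.symm
  · refine (ae_restrict_iff' measurableSet_Ioi).2 (Filter.Eventually.of_forall fun t ht => ?_)
    exact (Complex.hasSum_ofReal.2 (hsum t ht)).mul_right _

/-- The recursion defining `jumpProb`, as an identity of real numbers. -/
theorem toReal_jumpProb_succ (hr : ∀ y, (Function.support (r y)).Finite) (m : ℕ) {t : ℝ}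
    (ht : 0 ≤ t) (y x : S) :
    (jumpProb r (m + 1) t y x).toReal = ∑ z ∈ (hr y).toFinset,
      ∫ u in (0 : ℝ)..t, Real.exp (-(exitRate r y : ℝ) * u) * (r y z : ℝ) *
        (jumpProb r m (t - u) z x).toReal := by
  have hsumm : ∀ y, Summable (r y) := fun y => summable_of_hasFiniteSupport (hr y)
  have hle : ∀ z, ∀ u ∈ Set.Icc (0 : ℝ) t, jumpProb r m (t - u) z x ≤ 1 := fun z u hu =>
    jumpProb_le_one r hsumm m (sub_nonneg.2 hu.2) z x
  have hmeas : ∀ z, Measurable fun u : ℝ =>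
      ENNReal.ofReal (Real.exp (-(exitRate r y : ℝ) * u)) * (r y z : ℝ≥0∞) *
        jumpProb r m (t - u) z x := fun z => by
    refine Measurable.mul (by fun_prop) ?_
    exact (measurable_jumpProb r m z x).comp (by fun_prop)
  have hexp : ∀ u ∈ Set.Icc (0 : ℝ) t,
      ENNReal.ofReal (Real.exp (-(exitRate r y : ℝ) * u)) ≤ 1 := fun u hu => by
    rw [ENNReal.ofReal_le_one, Real.exp_le_one_iff]
    linarith [mul_nonneg (exitRate r y).coe_nonneg hu.1]
  have hfin : ∀ z, ∀ u ∈ Set.Icc (0 : ℝ) t,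
      ENNReal.ofReal (Real.exp (-(exitRate r y : ℝ) * u)) * (r y z : ℝ≥0∞) *
        jumpProb r m (t - u) z x ≤ r y z := fun z u hu =>
    calc _ ≤ 1 * (r y z : ℝ≥0∞) * 1 := by gcongr; exacts [hexp u hu, hle z u hu]
      _ = _ := by simp
  have h1 : jumpProb r (m + 1) t y x = ∑ z ∈ (hr y).toFinset, ∫⁻ u in Set.Icc (0 : ℝ) t,
      ENNReal.ofReal (Real.exp (-(exitRate r y : ℝ) * u)) * (r y z : ℝ≥0∞) *
        jumpProb r m (t - u) z x := by
    rw [jumpProb, ← lintegral_finsetSum _ fun z _ => hmeas z]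
    refine lintegral_congr fun u => tsum_eq_sum fun z hz => ?_
    have : r y z = 0 := by simpa using hz
    simp [this]
  rw [h1, ENNReal.toReal_sum]
  · refine Finset.sum_congr rfl fun z _ => ?_
    rw [intervalIntegral.integral_of_le ht, ← integral_Icc_eq_integral_Ioc, ← integral_toReal]
    · refine integral_congr_ae (Filter.Eventually.of_forall fun u => ?_)
      simp [ENNReal.toReal_mul, ENNReal.toReal_ofReal (Real.exp_nonneg _)]
    · exact (hmeas z).aemeasurable
    · exact (ae_restrict_iff' measurableSet_Icc).2 (Filter.Eventually.of_forall fun u hu =>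
        (hfin z u hu).trans_lt ENNReal.coe_lt_top)
  · intro z _
    refine ne_top_of_le_ne_top ?_ (setLIntegral_mono' measurableSet_Icc (hfin z))
    rw [setLIntegral_const]
    exact ENNReal.mul_ne_top ENNReal.coe_ne_top (by simp)

theorem laplaceJump_succ (hr : ∀ y, (Function.support (r y)).Finite) {s : ℂ} (hs : 0 < s.re)
    (m : ℕ) (y x : S) :
    laplaceJump r s (m + 1) y x = ∑ z ∈ (hr y).toFinset,
      ((r y z : ℝ) : ℂ) / (s + ((exitRate r y : ℝ) : ℂ)) * laplaceJump r s m z x := by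
  have hsumm : ∀ y, Summable (r y) := fun y => summable_of_hasFiniteSupport (hr y)
  have hs' : 0 < (s + ((exitRate r y : ℝ) : ℂ)).re := by
    simp only [Complex.add_re, Complex.ofReal_re]
    positivity
  set f : S → ℝ → ℂ := fun z u =>
    ((r y z : ℝ) : ℂ) * Complex.exp (-(s + ((exitRate r y : ℝ) : ℂ)) * u)
  set g : S → ℝ → ℂ := fun z v => ((jumpProb r m v z x).toReal : ℂ) * Complex.exp (-s * v)
  have hf : ∀ z, IntegrableOn (f z) (Set.Ioi 0) := fun z =>
    (integrableOn_cexp_neg_mul hs').const_mul _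
  have hg : ∀ z, IntegrableOn (g z) (Set.Ioi 0) := fun z =>
    integrableOn_jumpProb_mul r hsumm hs m z x
  -- `exp (-s * t)` factors as `exp (-s * u) * exp (-s * (t - u))` under the convolution.
  have h1 : ∀ t ∈ Set.Ioi (0 : ℝ),
      ((jumpProb r (m + 1) t y x).toReal : ℂ) * Complex.exp (-s * t) =
        ∑ z ∈ (hr y).toFinset, ∫ u in (0 : ℝ)..t,
          ContinuousLinearMap.mul ℝ ℂ (f z u) (g z (t - u)) := by
    intro t ht
    rw [toReal_jumpProb_succ r hr m (le_of_lt ht), Complex.ofReal_sum, Finset.sum_mul]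
    refine Finset.sum_congr rfl fun z _ => ?_
    rw [← intervalIntegral.integral_ofReal, ← intervalIntegral.integral_mul_const]
    refine intervalIntegral.integral_congr fun u _ => ?_
    simp only [f, g, ContinuousLinearMap.mul_apply', Complex.ofReal_mul, Complex.ofReal_exp]
    have : Complex.exp (-s * t) = Complex.exp (-s * u) * Complex.exp (-s * ((t - u : ℝ) : ℂ)) := by
      rw [← Complex.exp_add]
      congr 1
      push_cast
      ring
    have h2 : Complex.exp (-(s + ((exitRate r y : ℝ) : ℂ)) * u) =
        Complex.exp (-s * u) * Complex.exp (((-(exitRate r y : ℝ) * u : ℝ) : ℂ)) := by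
      rw [← Complex.exp_add]
      congr 1
      push_cast
      ring
    rw [this, h2, Complex.ofReal_mul]
    push_cast
    ring
  have hint : ∀ z, IntegrableOn (fun t : ℝ => ∫ u in (0 : ℝ)..t,
      ContinuousLinearMap.mul ℝ ℂ (f z u) (g z (t - u))) (Set.Ioi 0) := fun z => by
    have := integrable_posConvolution (hf z) (hg z) (ContinuousLinearMap.mul ℝ ℂ)
    rw [posConvolution, integrable_indicator_iff measurableSet_Ioi] at this
    exact this
  unfold laplaceJump
  rw [setIntegral_congr_fun measurableSet_Ioi h1, integral_finsetSum _ fun z _ => hint z]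
  refine Finset.sum_congr rfl fun z _ => ?_
  rw [integral_posConvolution (hf z) (hg z), ContinuousLinearMap.mul_apply']
  congr 1
  simp only [f]
  rw [integral_const_mul, integral_cexp_neg_mul hs', mul_one_div]

/-- The last-jump decomposition. `laplaceJump_succ` decomposes at the first jump; as both sides
are products of the same matrices, the two decompositions agree by induction. -/
theorem laplaceJump_succ_last (hr : ∀ y, (Function.support (r y)).Finite)
    (hc : ∀ x, (Function.support fun z => r z x).Finite) {s : ℂ} (hs : 0 < s.re)
    (m : ℕ) (y x : S) :
    laplaceJump r s (m + 1) y x = ∑ z ∈ (hc x).toFinset,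
      laplaceJump r s m y z * (((r z x : ℝ) : ℂ) / (s + ((exitRate r x : ℝ) : ℂ))) := by
  induction m generalizing y with
  | zero =>
    rw [laplaceJump_succ r hr hs]
    simp only [laplaceJump_zero r hs, mul_ite, ite_mul, mul_zero, zero_mul, Finset.sum_ite_eq,
      Finset.sum_ite_eq', Set.Finite.mem_toFinset, Function.mem_support]
    split_ifs
    · ring
    · rfl
  | succ m ih =>
    rw [laplaceJump_succ r hr hs]
    simp_rw [ih, laplaceJump_succ r hr hs m y, Finset.mul_sum, Finset.sum_mul]
    rw [Finset.sum_comm]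
    simp_rw [mul_assoc]

/-- The forward equation for the Laplace transform of the transition probabilities. -/
theorem laplaceProb_forward (hr : ∀ y, (Function.support (r y)).Finite)
    (hc : ∀ x, (Function.support fun z => r z x).Finite) {s : ℂ} (hs : 0 < s.re) (y x : S) :
    (s + ((exitRate r x : ℝ) : ℂ)) * laplaceProb r s y x =
      (if x = y then 1 else 0) + ∑' z, ((r z x : ℝ) : ℂ) * laplaceProb r s y z := by
  have hsumm : ∀ y, Summable (r y) := fun y => summable_of_hasFiniteSupport (hr y)
  have h0 := rate_add_ne_zero hs (exitRate r x)
  have h1 : HasSum (fun m => laplaceJump r s (m + 1) y x) (∑ z ∈ (hc x).toFinset,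
      laplaceProb r s y z * (((r z x : ℝ) : ℂ) / (s + ((exitRate r x : ℝ) : ℂ)))) := by
    simp_rw [laplaceJump_succ_last r hr hc hs]
    exact hasSum_sum fun z _ => (hasSum_laplaceJump r hsumm hs y z).mul_right _
  have h2 := (hasSum_nat_add_iff (f := fun m => laplaceJump r s m y x) 1).1 h1
  rw [Finset.sum_range_one, laplaceJump_zero r hs] at h2
  have h3 : ∑' z, ((r z x : ℝ) : ℂ) * laplaceProb r s y z =
      ∑ z ∈ (hc x).toFinset, ((r z x : ℝ) : ℂ) * laplaceProb r s y z := by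
    refine tsum_eq_sum fun z hz => ?_
    have : r z x = 0 := by simpa using hz
    simp [this]
  rw [(hasSum_laplaceJump r hsumm hs y x).unique h2, h3, mul_add, Finset.mul_sum, add_comm]
  · congr 1
    · split_ifs with h
      · subst h
        field_simp
      · simp
    · refine Finset.sum_congr rfl fun z _ => ?_
      field_simp

omit [Countable S] in
/-- If no jump leads from outside a set into it, the chain started outside never enters it. -/
theorem laplaceProb_eq_zero (s : ℂ) (P : S → Prop) (hP : ∀ y z, ¬ P y → P z → r y z = 0) {y x : S}
    (hy : ¬ P y) (hx : P x) : laplaceProb r s y x = 0 := by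
  have h : ∀ m, ∀ y, ¬ P y → ∀ t, jumpProb r m t y x = 0 := by
    intro m
    induction m with
    | zero =>
      intro y hy t
      rw [jumpProb, if_neg]
      rintro rfl
      exact hy hx
    | succ m ih =>
      intro y hy t
      rw [jumpProb]
      have : ∀ u : ℝ, ∑' z, ENNReal.ofReal (Real.exp (-(exitRate r y : ℝ) * u)) *
          (r y z : ℝ≥0∞) * jumpProb r m (t - u) z x = 0 := fun u => by
        refine ENNReal.tsum_eq_zero.2 fun z => ?_
        by_cases hz : P z
        · simp [hP y z hy hz]
        · simp [ih z hz]
      simp_rw [this, lintegral_zero]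
  simp [laplaceProb, transProb, h _ y hy]

end Chain

/-! ### Inverting a diagonally dominant operator on `L¹` -/

section Diagonal

variable {X : Type*}

@[simp]
theorem kernelOp_apply {Y : Type*} (K : X → Y → ℂ) (C : ℝ) (hC : 0 ≤ C)
    (hK : ∀ y, ∑' x, ‖K x y‖ₑ ≤ ENNReal.ofReal C) (f : L1 Y) (x : X) :
    kernelOp K C hC hK f x = ∑' y, K x y * f y := rfl

theorem tsum_diag_le [DecidableEq X] {w : X → ℂ} {C : ℝ} (hw : ∀ x, ‖w x‖ ≤ C) (y : X) :
    ∑' x, ‖(if x = y then w y else 0 : ℂ)‖ₑ ≤ ENNReal.ofReal C := by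
  rw [tsum_eq_single y fun x hx => by simp [hx], if_pos rfl, ← ofReal_norm]
  exact ENNReal.ofReal_le_ofReal (hw y)

/-- Multiplication by a bounded function `w` on `L¹`. -/
def diagOp [DecidableEq X] (w : X → ℂ) (C : ℝ) (hC : 0 ≤ C) (hw : ∀ x, ‖w x‖ ≤ C) :
    L1 X →L[ℂ] L1 X :=
  kernelOp (fun x y => if x = y then w y else 0) C hC (tsum_diag_le hw)

@[simp]
theorem diagOp_apply [DecidableEq X] (w : X → ℂ) (C : ℝ) (hC : 0 ≤ C) (hw : ∀ x, ‖w x‖ ≤ C)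
    (f : L1 X) (x : X) : diagOp w C hC hw f x = w x * f x := by
  rw [diagOp, kernelOp_apply, tsum_eq_single x fun y hy => by simp [hy.symm], if_pos rfl]

/-- Factor `W - K = (1 - K W⁻¹) W`, where `W` is multiplication by `w`; the first factor is
inverted by a Neumann series. -/
theorem isUnit_diagOp_sub_kernelOp [DecidableEq X] {w : X → ℂ} {C : ℝ} (hC : 0 ≤ C)
    (hw : ∀ x, ‖w x‖ ≤ C) {K : X → X → ℂ} {D : ℝ} (hD : 0 ≤ D)
    (hK : ∀ y, ∑' x, ‖K x y‖ₑ ≤ ENNReal.ofReal D) {ε ρ : ℝ} (hε : 0 < ε) (hρ : 0 ≤ ρ)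
    (hρ1 : ρ < 1) (hwε : ∀ x, ε ≤ ‖w x‖)
    (hKw : ∀ y, ∑' x, ‖K x y‖ₑ ≤ ENNReal.ofReal (ρ * ‖w y‖)) :
    IsUnit (diagOp w C hC hw - kernelOp K D hD hK) := by
  have hw0 : ∀ x, w x ≠ 0 := fun x => norm_pos_iff.1 (hε.trans_le (hwε x))
  have hinv : ∀ x, ‖(w x)⁻¹‖ ≤ ε⁻¹ := fun x => by
    rw [norm_inv]
    exact inv_anti₀ hε (hwε x)
  have hKi : ∀ y, ∑' x, ‖K x y * (w y)⁻¹‖ₑ ≤ ENNReal.ofReal ρ := fun y => by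
    simp_rw [enorm_mul]
    rw [ENNReal.tsum_mul_right]
    refine (mul_le_mul' (hKw y) le_rfl).trans_eq ?_
    rw [← ofReal_norm, ← ENNReal.ofReal_mul (by positivity), norm_inv, mul_assoc,
      mul_inv_cancel₀ (norm_ne_zero_iff.2 (hw0 y)), mul_one]
  have hfac : diagOp w C hC hw - kernelOp K D hD hK =
      (1 - kernelOp (fun x y => K x y * (w y)⁻¹) ρ hρ hKi) * diagOp w C hC hw := by
    rw [sub_mul, one_mul]
    congr 1
    ext f x
    rw [mul_apply_eq_comp, kernelOp_apply, kernelOp_apply]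
    refine tsum_congr fun y => ?_
    rw [diagOp_apply, mul_assoc, inv_mul_cancel_left₀ (hw0 y)]
  have h1 : IsUnit (diagOp w C hC hw) := by
    refine ⟨⟨diagOp w C hC hw, diagOp (fun x => (w x)⁻¹) ε⁻¹ (by positivity) hinv, ?_, ?_⟩, rfl⟩
    · ext f x
      simp [hw0 x]
    · ext f x
      simp [hw0 x]
  have h2 : ‖kernelOp (fun x y => K x y * (w y)⁻¹) ρ hρ hKi‖ < 1 :=
    (LinearMap.mkContinuous_norm_le _ hρ _).trans_lt hρ1
  rw [hfac]
  exact (Units.oneSub _ h2).isUnit.mul h1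

end Diagonal

/-! ### The rates of the exclusion process -/

theorem tsum_ite_and_eq (P : Prop) [Decidable P] (ζ : Finset ℕ) (a : ℝ≥0) :
    ∑' ξ : Finset ℕ, (if P ∧ ξ = ζ then a else 0) = if P then a else 0 := by
  by_cases hP : P
  · simp only [hP, true_and, if_true]
    exact tsum_ite_eq ζ fun _ => a
  · simp [hP]

theorem exitRate_asepRate_le {p q : ℝ≥0} (hpq : p + q = 1) (η : Finset ℕ) :
    exitRate (asepRate p q) η ≤ η.card := by
  have h1 : ∀ i, Summable fun ξ : Finset ℕ =>
      if i + 1 ∉ η ∧ ξ = insert (i + 1) (η.erase i) then p else 0 := fun i =>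
    summable_ite _ _ _
  have h2 : ∀ i, Summable fun ξ : Finset ℕ =>
      if 0 < i ∧ i - 1 ∉ η ∧ ξ = insert (i - 1) (η.erase i) then q else 0 := fun i => by
    simp_rw [← and_assoc]
    exact summable_ite _ _ _
  unfold exitRate asepRate
  rw [Summable.tsum_finsetSum fun i _ => (h1 i).add (h2 i)]
  calc _ ≤ ∑ i ∈ η, (1 : ℝ≥0) := by
        refine Finset.sum_le_sum fun i _ => ?_
        rw [(h1 i).tsum_add (h2 i)]
        simp_rw [← and_assoc]
        rw [tsum_ite_and_eq, tsum_ite_and_eq, ← hpq]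
        gcongr <;> split_ifs <;> simp
    _ = _ := by simp

theorem openRate_zero_zero (p q : ℝ≥0) : openRate p q 0 0 = asepRate p q := by
  ext η ξ
  simp [openRate]

theorem openRate_zero (p q β : ℝ≥0) (η ξ : Finset ℕ) :
    openRate p q 0 β η ξ = asepRate p q η ξ + if 0 ∈ η ∧ ξ = η.erase 0 then β else 0 := by
  simp [openRate]

theorem exitRate_openRate (p q β : ℝ≥0) (η : Finset ℕ) :
    exitRate (openRate p q 0 β) η =
      exitRate (asepRate p q) η + if 0 ∈ η then β else 0 := by
  unfold exitRate
  simp_rw [openRate_zero]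
  rw [(summable_asepRate p q η).tsum_add (summable_ite _ _ _), tsum_ite_and_eq]

theorem exists_of_asepRate_ne_zero {p q : ℝ≥0} {η ξ : Finset ℕ} (h : asepRate p q η ξ ≠ 0) :
    ∃ i ∈ η, ∃ j ∉ η, j ≤ i + 1 ∧ i ≤ j + 1 ∧ ξ = insert j (η.erase i) := by
  obtain ⟨i, hi, hne⟩ := Finset.exists_ne_zero_of_sum_ne_zero h
  refine ⟨i, hi, ?_⟩
  by_cases h1 : i + 1 ∉ η ∧ ξ = insert (i + 1) (η.erase i)
  · exact ⟨i + 1, h1.1, le_rfl, by omega, h1.2⟩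
  · by_cases h2 : 0 < i ∧ i - 1 ∉ η ∧ ξ = insert (i - 1) (η.erase i)
    · exact ⟨i - 1, h2.2.1, by omega, by omega, h2.2.2⟩
    · simp [h1, h2] at hne

theorem card_eq_of_asepRate_ne_zero {p q : ℝ≥0} {η ξ : Finset ℕ} (h : asepRate p q η ξ ≠ 0) :
    ξ.card = η.card := by
  obtain ⟨i, hi, j, hj, -, -, rfl⟩ := exists_of_asepRate_ne_zero h
  rw [Finset.card_insert_of_notMem (fun hj' => hj (Finset.mem_of_mem_erase hj')),
    Finset.card_erase_add_one hi]

theorem card_le_of_openRate_ne_zero {p q β : ℝ≥0} {η ξ : Finset ℕ}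
    (h : openRate p q 0 β η ξ ≠ 0) : ξ.card ≤ η.card := by
  rw [openRate_zero] at h
  by_cases h1 : asepRate p q η ξ = 0
  · rw [h1, zero_add, ite_ne_right_iff] at h
    rw [h.1.2]
    exact Finset.card_erase_le
  · exact (card_eq_of_asepRate_ne_zero h1).le

theorem subset_range_of_openRate_ne_zero {p q β : ℝ≥0} {η ξ : Finset ℕ}
    (h : openRate p q 0 β η ξ ≠ 0) :
    ξ ⊆ Finset.range (η.sup id + 2) ∧ η ⊆ Finset.range (ξ.sup id + 2) := by
  have hsup : ∀ (ζ : Finset ℕ), ∀ a ∈ ζ, a ≤ ζ.sup id := fun ζ a ha =>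
    Finset.le_sup (f := id) ha
  rw [openRate_zero] at h
  by_cases h1 : asepRate p q η ξ = 0
  · rw [h1, zero_add, ite_ne_right_iff] at h
    obtain ⟨⟨h0, rfl⟩, -⟩ := h
    constructor
    · intro a ha
      have := hsup _ a (Finset.mem_of_mem_erase ha)
      rw [Finset.mem_range]
      omega
    · intro a ha
      rw [Finset.mem_range]
      by_cases ha0 : a = 0
      · omega
      · have := hsup _ a (Finset.mem_erase.2 ⟨ha0, ha⟩)
        omega
  · obtain ⟨i, hi, j, hj, hji, hij, rfl⟩ := exists_of_asepRate_ne_zero h1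
    constructor
    · intro a ha
      rw [Finset.mem_range]
      have := hsup _ i hi
      rcases Finset.mem_insert.1 ha with rfl | ha
      · omega
      · have := hsup _ a (Finset.mem_of_mem_erase ha)
        omega
    · intro a ha
      rw [Finset.mem_range]
      have := hsup _ j (Finset.mem_insert_self j (η.erase i))
      by_cases hai : a = i
      · omega
      · have := hsup _ a (Finset.mem_insert_of_mem (a := a) (b := j)
          (Finset.mem_erase.2 ⟨hai, ha⟩))
        omega

theorem finite_support_openRate (p q β : ℝ≥0) (η : Finset ℕ) :
    (Function.support (openRate p q 0 β η)).Finite :=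
  (Finset.finite_toSet (Finset.range (η.sup id + 2)).powerset).subset fun _ h =>
    Finset.mem_coe.2 (Finset.mem_powerset.2 (subset_range_of_openRate_ne_zero h).1)

theorem finite_support_openRate_left (p q β : ℝ≥0) (ξ : Finset ℕ) :
    (Function.support fun η => openRate p q 0 β η ξ).Finite :=
  (Finset.finite_toSet (Finset.range (ξ.sup id + 2)).powerset).subset fun _ h =>
    Finset.mem_coe.2 (Finset.mem_powerset.2 (subset_range_of_openRate_ne_zero h).2)

/-! ### The forward equation on `n`-particle configurations -/

theorem tsum_asepRate_le (p q : ℝ≥0) (n : ℕ) (y : Config n) :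
    ∑' x : Config n, ‖((asepRate p q y.1 x.1 : ℝ) : ℂ)‖ₑ ≤
      ENNReal.ofReal (exitRate (asepRate p q) y.1) := by
  have h : ∀ a : ℝ≥0, ‖((a : ℝ) : ℂ)‖ₑ = (a : ℝ≥0∞) := fun a => by
    rw [← ofReal_norm, Complex.norm_real, Real.norm_of_nonneg a.coe_nonneg,
      ENNReal.ofReal_coe_nnreal]
  simp_rw [h]
  rw [ENNReal.ofReal_coe_nnreal, exitRate, ENNReal.coe_tsum (summable_asepRate p q y.1)]
  exact ENNReal.tsum_comp_le_tsum_of_injective Subtype.val_injective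
    fun x => (asepRate p q y.1 x : ℝ≥0∞)

theorem norm_exitRate_le {p q : ℝ≥0} (hpq : p + q = 1) (β : ℝ≥0) (s : ℂ) (n : ℕ) (x : Config n) :
    ‖s + ((exitRate (openRate p q 0 β) x.1 : ℝ) : ℂ)‖ ≤ ‖s‖ + (n + β) := by
  refine (norm_add_le _ _).trans (add_le_add le_rfl ?_)
  rw [Complex.norm_real, Real.norm_of_nonneg (NNReal.coe_nonneg _), exitRate_openRate]
  have h1 := exitRate_asepRate_le hpq x.1
  rw [x.2] at h1
  have h2 : (if 0 ∈ x.1 then β else 0) ≤ β := by split_ifs <;> simp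
  exact_mod_cast add_le_add h1 h2

theorem tsum_asepRate_le_card {p q : ℝ≥0} (hpq : p + q = 1) (n : ℕ) (y : Config n) :
    ∑' x : Config n, ‖((asepRate p q y.1 x.1 : ℝ) : ℂ)‖ₑ ≤ ENNReal.ofReal n := by
  refine (tsum_asepRate_le p q n y).trans (ENNReal.ofReal_le_ofReal ?_)
  have h1 := exitRate_asepRate_le hpq y.1
  rw [y.2] at h1
  exact_mod_cast h1

/-- The operator `s - G + β δ` on `E n`, where `G` is the forward generator of the exclusion
process without reservoir: multiplication by `s` plus the exit rates of the open process, minus the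
operator whose kernel is the transposed matrix of the jump rates within `n`-particle
configurations. -/
def forwardOp {p q : ℝ≥0} (hpq : p + q = 1) (β : ℝ≥0) (s : ℂ) (n : ℕ) : E n →L[ℂ] E n :=
  diagOp (fun x : Config n => s + ((exitRate (openRate p q 0 β) x.1 : ℝ) : ℂ)) (‖s‖ + (n + β))
      (by positivity) (norm_exitRate_le hpq β s n) -
    kernelOp (fun x y : Config n => ((asepRate p q y.1 x.1 : ℝ) : ℂ)) n (by positivity)
      (tsum_asepRate_le_card hpq n)

theorem forwardOp_apply {p q : ℝ≥0} (hpq : p + q = 1) (β : ℝ≥0) (s : ℂ) (n : ℕ) (f : E n)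
    (x : Config n) : forwardOp hpq β s n f x =
      (s + ((exitRate (openRate p q 0 β) x.1 : ℝ) : ℂ)) * f x -
        ∑' y : Config n, ((asepRate p q y.1 x.1 : ℝ) : ℂ) * f y := by
  rw [forwardOp, sub_apply, lp.coeFn_sub, Pi.sub_apply, diagOp_apply,
    kernelOp_apply]

/-- The total jump rate `c ≤ n` out of a configuration is at most `n / (Re s + n)` times the
diagonal entry, whose real part is at least `Re s + c`. -/
theorem isUnit_forwardOp {p q : ℝ≥0} (hpq : p + q = 1) (β : ℝ≥0) {s : ℂ} (hs : 0 < s.re)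
    (n : ℕ) : IsUnit (forwardOp hpq β s n) := by
  have hre : ∀ x : Config n, s.re + exitRate (asepRate p q) x.1 ≤
      ‖s + ((exitRate (openRate p q 0 β) x.1 : ℝ) : ℂ)‖ := fun x => by
    refine le_trans ?_ (Complex.re_le_norm _)
    rw [exitRate_openRate, Complex.add_re, Complex.ofReal_re, NNReal.coe_add]
    linarith [(if 0 ∈ x.1 then β else 0 : ℝ≥0).coe_nonneg]
  have hpos : 0 < s.re + n := by positivity
  refine isUnit_diagOp_sub_kernelOp _ _ _ _ (ε := s.re) (ρ := n / (s.re + n)) hs (by positivity)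
    ((div_lt_one hpos).2 (by linarith)) (fun x => ?_) (fun y => ?_)
  · linarith [hre x, (exitRate (asepRate p q) x.1).coe_nonneg]
  · refine (tsum_asepRate_le p q n y).trans (ENNReal.ofReal_le_ofReal ?_)
    have h1 := exitRate_asepRate_le hpq y.1
    rw [y.2] at h1
    have h2 : (exitRate (asepRate p q) y.1 : ℝ) ≤ n := by exact_mod_cast h1
    refine le_trans ?_ (mul_le_mul_of_nonneg_left (hre y) (by positivity))
    rw [div_mul_eq_mul_div, le_div_iff₀ hpos]
    nlinarith

theorem opDelta_apply (n : ℕ) (f : E n) (x : Config n) :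
    opDelta n f x = if 0 ∈ x.1 then f x else 0 := rfl

theorem opB_apply (n : ℕ) (f : E (n + 1)) (x : Config n) :
    opB n f x = if h : 0 ∉ x.1 then f (addZero ⟨x, h⟩) else 0 := rfl

theorem Phat_apply (p q α β : ℝ≥0) (y : Finset ℕ) (s : ℂ) (hs : 0 < s.re) (n : ℕ)
    (x : Config n) : Phat p q α β y s hs n x = laplaceProb (openRate p q α β) s y x.1 := rfl

theorem forwardOp_eq_add {p q : ℝ≥0} (hpq : p + q = 1) (β : ℝ≥0) (s : ℂ) (n : ℕ) :
    forwardOp hpq β s n = forwardOp hpq 0 s n + ((β : ℝ) : ℂ) • opDelta n := by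
  ext f x
  rw [add_apply, smul_apply, lp.coeFn_add, Pi.add_apply,
    lp.coeFn_smul, Pi.smul_apply, forwardOp_apply, forwardOp_apply, opDelta_apply,
    exitRate_openRate, exitRate_openRate]
  split_ifs <;> (simp; try ring)

/-- The forward equation of the open process, started at `y`, on `n`-particle configurations: the
sources are the initial condition and the ejections from `n + 1` particles. -/
theorem forwardOp_Phat_apply {p q : ℝ≥0} (hpq : p + q = 1) (β : ℝ≥0) (y : Finset ℕ) {s : ℂ}
    (hs : 0 < s.re) (n : ℕ) (x : Config n) :
    forwardOp hpq β s n (Phat p q 0 β y s hs n) x = (if x.1 = y then 1 else 0) +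
      ((β : ℝ) : ℂ) * opB n (Phat p q 0 β y s hs (n + 1)) x := by
  set l : Finset ℕ → ℂ := laplaceProb (openRate p q 0 β) s y
  have hf := laplaceProb_forward (openRate p q 0 β) (finite_support_openRate p q β)
    (finite_support_openRate_left p q β) hs y x.1
  have hA : (Function.support fun z => ((asepRate p q z x.1 : ℝ) : ℂ) * l z).Finite := by
    refine (finite_support_openRate_left p q 0 x.1).subset fun z hz => ?_
    simp only [openRate_zero_zero]
    rintro h
    exact hz (by simp [h])
  have hB : ∀ z ≠ insert 0 x.1, (((if 0 ∈ z ∧ x.1 = z.erase 0 then β else 0 : ℝ≥0) : ℝ) : ℂ) *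
      l z = 0 := fun z hz => by
    rw [if_neg]
    · simp
    · rintro ⟨h0, hx⟩
      exact hz (by rw [hx, Finset.insert_erase h0])
  have hsplit : ∑' z, ((openRate p q 0 β z x.1 : ℝ) : ℂ) * l z =
      ∑' z : Config n, ((asepRate p q z.1 x.1 : ℝ) : ℂ) * l z.1 +
        ((β : ℝ) : ℂ) * opB n (Phat p q 0 β y s hs (n + 1)) x := by
    simp_rw [openRate_zero, NNReal.coe_add, Complex.ofReal_add, add_mul]
    rw [Summable.tsum_add (summable_of_hasFiniteSupport hA)
      (summable_of_ne_finset_zero (s := {insert 0 x.1}) fun z hz => hB z (by simpa using hz)),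
      tsum_eq_single _ hB]
    congr 1
    · refine (tsum_subtype_eq_of_support_subset (s := {z : Finset ℕ | z.card = n})
        fun z hz => ?_).symm
      have h : asepRate p q z x.1 ≠ 0 := fun h => hz (by simp [h])
      exact (card_eq_of_asepRate_ne_zero h).symm.trans x.2
    · rw [opB_apply]
      by_cases h : 0 ∈ x.1
      · have hx : x.1 ≠ (insert 0 x.1).erase 0 := fun hx =>
          Finset.notMem_erase 0 (insert 0 x.1) (hx ▸ h)
        rw [if_neg fun h' => hx h'.2]
        simp [h]
      · simp [h, Phat_apply, addZero, l]
  rw [forwardOp_apply]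
  simp only [Phat_apply]
  rw [hf, hsplit]
  ring

theorem Phat_eq_zero (p q β : ℝ≥0) {k : ℕ} (y : Config k) {s : ℂ} (hs : 0 < s.re) {n : ℕ}
    (hn : k < n) : Phat p q 0 β y.1 s hs n = 0 := by
  ext x
  rw [Phat_apply, lp.coeFn_zero, Pi.zero_apply]
  refine laplaceProb_eq_zero _ s (fun z => k < z.card) (fun z w hz hw => ?_)
    (by simp [y.2]) (by simpa [x.2] using hn)
  by_contra h
  exact hz (hw.trans_le (card_le_of_openRate_ne_zero h))

theorem forwardOp_Phat_self {p q : ℝ≥0} (hpq : p + q = 1) (β : ℝ≥0) {k : ℕ} (y : Config k) {s : ℂ}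
    (hs : 0 < s.re) :
    forwardOp hpq β s k (Phat p q 0 β y.1 s hs k) = lp.single 1 y (1 : ℂ) := by
  ext x
  rw [forwardOp_Phat_apply, Phat_eq_zero p q β y hs (Nat.lt_succ_self k), map_zero, lp.coeFn_zero,
    Pi.zero_apply, mul_zero, add_zero, lp.single_apply, Pi.single_apply]
  simp only [Subtype.ext_iff]

theorem forwardOp_Phat_of_lt {p q : ℝ≥0} (hpq : p + q = 1) (β : ℝ≥0) {k : ℕ} (y : Config k) {s : ℂ}
    (hs : 0 < s.re) {n : ℕ} (hn : n < k) :
    forwardOp hpq β s n (Phat p q 0 β y.1 s hs n) =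
      ((β : ℝ) : ℂ) • opB n (Phat p q 0 β y.1 s hs (n + 1)) := by
  ext x
  rw [forwardOp_Phat_apply, if_neg, zero_add, lp.coeFn_smul, Pi.smul_apply, smul_eq_mul]
  intro h
  exact hn.ne (by rw [← x.2, h, y.2])

/-! ### The resolvent identity -/

theorem opL_single (p q : ℝ≥0) {s : ℂ} (hs : 0 < s.re) {n : ℕ} (y : Config n) :
    opL p q s hs n (lp.single 1 y (1 : ℂ)) = Phat p q 0 0 y.1 s hs n := by
  ext x
  rw [opL, kernelOp_apply, Phat_apply, openRate_zero_zero,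
    tsum_eq_single y fun z hz => by rw [lp.single_apply_ne _ _ _ hz, mul_zero],
    lp.single_apply_self, mul_one]

theorem forwardOp_mul_opL {p q : ℝ≥0} (hpq : p + q = 1) {s : ℂ} (hs : 0 < s.re) (n : ℕ) :
    forwardOp hpq 0 s n * opL p q s hs n = 1 := by
  refine lp.ext_continuousLinearMap ENNReal.one_ne_top fun y => ?_
  ext1
  change forwardOp hpq 0 s n (opL p q s hs n (lp.single 1 y (1 : ℂ))) = lp.single 1 y (1 : ℂ)
  rw [opL_single, forwardOp_Phat_self]

theorem opL_mul_forwardOp {p q : ℝ≥0} (hpq : p + q = 1) {s : ℂ} (hs : 0 < s.re) (n : ℕ) :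
    opL p q s hs n * forwardOp hpq 0 s n = 1 := by
  obtain ⟨u, hu⟩ := isUnit_forwardOp hpq 0 hs n
  have h := forwardOp_mul_opL hpq hs n
  rw [← hu] at h ⊢
  rw [← Units.inv_eq_of_mul_eq_one_right h, u.inv_mul]

theorem boundaryOp_eq {p q : ℝ≥0} (hpq : p + q = 1) (β : ℝ≥0) {s : ℂ} (hs : 0 < s.re) (n : ℕ) :
    boundaryOp p q 0 β s hs n = opL p q s hs n * forwardOp hpq β s n := by
  rw [forwardOp_eq_add, mul_add, opL_mul_forwardOp hpq hs, boundaryOp, mul_smul_comm]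
  simp [sub_eq_add_neg]

theorem isUnit_boundaryOp {p q : ℝ≥0} (hpq : p + q = 1) (β : ℝ≥0) {s : ℂ} (hs : 0 < s.re)
    (n : ℕ) : IsUnit (boundaryOp p q 0 β s hs n) := by
  rw [boundaryOp_eq hpq]
  refine IsUnit.mul ?_ (isUnit_forwardOp hpq β hs n)
  exact ⟨⟨_, _, opL_mul_forwardOp hpq hs n, forwardOp_mul_opL hpq hs n⟩, rfl⟩

theorem eq_opM_opL {p q : ℝ≥0} (hpq : p + q = 1) (β : ℝ≥0) {s : ℂ} (hs : 0 < s.re) {n : ℕ}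
    {f g : E n} (h : forwardOp hpq β s n f = g) :
    f = opM p q 0 β s hs n (opL p q s hs n g) := by
  rw [← h, opM, ← mul_apply_eq_comp (opL p q s hs n), ← boundaryOp_eq hpq,
    ← mul_apply_eq_comp, Ring.inverse_mul_cancel _ (isUnit_boundaryOp hpq β hs n),
    one_apply_eq_self]

end OpenASEP

end

theorem corollary1p2 (p q β : ℝ≥0) (hpq : p + q = 1) (k : ℕ) (y : OpenASEP.Config k)
    (s : ℂ) (hs : 0 < s.re) :
    (∀ n, IsUnit (OpenASEP.boundaryOp p q 0 β s hs n)) ∧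
    OpenASEP.Phat p q 0 β y.1 s hs k =
      OpenASEP.opM p q 0 β s hs k (OpenASEP.opL p q s hs k (lp.single 1 y (1 : ℂ))) ∧
    ∀ n < k, OpenASEP.Phat p q 0 β y.1 s hs n =
      ((β : ℝ) : ℂ) • OpenASEP.opM p q 0 β s hs n (OpenASEP.opL p q s hs n
        (OpenASEP.opB n (OpenASEP.Phat p q 0 β y.1 s hs (n + 1)))) := by
  refine ⟨OpenASEP.isUnit_boundaryOp hpq β hs,
    OpenASEP.eq_opM_opL hpq β hs (OpenASEP.forwardOp_Phat_self hpq β y hs), fun n hn => ?_⟩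
  rw [← map_smul, ← map_smul]
  exact OpenASEP.eq_opM_opL hpq β hs (OpenASEP.forwardOp_Phat_of_lt hpq β y hs hn)
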